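/- Let $(\Omega,\mathcal F,\mathbb P)$ be a probability space, let $L^0$ be the space of real-valued measurable functions on $\Omega$ modulo a.e. equality, and let $d\in\mathbb N$. Equip $(L^0)^d$ with the Euclidean $L^0$-norm $\|x\|=(\sum_{i=1}^d x_i^2)^{1/2}\in L^0$ and with the topology having as base the balls $B_r(x)=\{y : \|x-y\|<r \text{ a.e.}\}$, where $x\in(L^0)^d$ and $r\in L^0$ with $r>0$ a.e. "Closed" refers to this topology. For a countable measurable partition $(A_k)$ of $\Omega$ (up to null sets) and $x_k\in(L^0)^d$, the concatenation $\sum_k 1_{A_k}x_k$ is the unique $x\in(L^0)^d$ with $1_{A_k}x=1_{A_k}x_k$ for all $k$. A set $Y\subset (L^0)^d$ is *stable* if it is nonempty and contains every concatenation of its elements along every countable measurable partition. A *stable collection of stable sets* is a nonempty collection $\mathscr Y$ of stable sets such that $\{\sum_k 1_{A_k}y_k : y_k\in Y_k\}\in\mathscr Y$ for all $Y_k\in\mathscr Y$ and all countable measurable partitions $(A_k)$. A *stable filter* on a stable set $K$ is a filter on $K$ that has a filter base which is a stable collection of stable subsets of $K$. A set $K$ is *stable compact* if it is stable and every stable filter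 on $K$ has a cluster point in $K$. It is *bounded* if for some $x_0\in K$ the family $\{\|x_0-x\| : x\in K\}$ is bounded above by an element of $L^0$. It is *sequentially closed* if $x\in K$ whenever $x_n\in K$ for all $n$ and $x_n\to x$ a.e. A multifunction $S:\Omega\rightrightarrows\mathbb R^d$ is *measurable* if $\{\omega : S(\omega)\cap C\neq\emptyset\}\in\mathcal F$ for every closed $C\subset\mathbb R^d$; a *measurable selector* of $S$ is a measurable function $f:\Omega\to\mathbb R^d$ with $f(\omega)\in S(\omega)$ for all $\omega$. **Theorem.** Let $K$ be a subset of $(L^0)^d$. Then the following are equivalent. (i) $K$ is stable compact. (ii) $K$ is stable, closed and bounded. (iii) $K$ is stable, sequentially closed and bounded. (iv) $K$ is the set of equivalence classes of measurable selectors of a measurable multifunction $S_K:\Omega\rightrightarrows\mathbb R^d$ with nonempty compact values. In this case the multifunction $S_K$ in (iv) is unique up to a.e. equality: if $S$ and $S'$ are two multifunctions as in (iv) for the same $K$, then $S(\omega)=S'(\omega)$ for a.e. $\omega$. -/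

import Mathlib

open MeasureTheory Filter Topology

namespace StableL0

variable {Ω : Type*} [MeasurableSpace Ω]

/-- `L⁰`: real-valued measurable functions modulo almost everywhere equality. -/
abbrev L0 (P : Measure Ω) : Type _ := Ω →ₘ[P] ℝ

/-- The `L⁰`-module `(L⁰)^d`. -/
abbrev L0d (P : Measure Ω) (d : ℕ) : Type _ := Fin d → L0 P

variable {P : Measure Ω} {d : ℕ}

/-- `(A k)` represents a countable partition of unity in the measure algebra of `P`.
Null sets are allowed among the `A k`, so finite partitions are included. -/
structure IsPartition (P : Measure Ω) (A : ℕ → Set Ω) : Prop where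
  measurableSet : ∀ k, MeasurableSet (A k)
  aedisjoint : Pairwise fun j k => AEDisjoint P (A j) (A k)
  cover : ∀ᵐ ω ∂P, ω ∈ ⋃ k, A k

/-- `y` is the concatenation `∑ₖ 1_{A k} x k`, that is, `1_{A k} y = 1_{A k} x k` for all `k`. -/
def IsConcat (A : ℕ → Set Ω) (x : ℕ → L0d P d) (y : L0d P d) : Prop :=
  ∀ k i, ∀ᵐ ω ∂P, ω ∈ A k → y i ω = x k i ω

/-- Concatenations exist and are unique. -/
theorem existsUnique_isConcat {A : ℕ → Set Ω} (hA : IsPartition P A) (x : ℕ → L0d P d) :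
    ∃! y, IsConcat A x y := by
  classical
  have key : ∀ i, ∃ y : L0 P, ∀ k, ∀ᵐ ω ∂P, ω ∈ A k → y ω = x k i ω := by
    intro i
    have hex : ∀ ω, ∃ n, ω ∈ A n ∨ ω ∉ ⋃ k, A k := by
      intro ω
      by_cases h : ω ∈ ⋃ k, A k
      · obtain ⟨n, hn⟩ := Set.mem_iUnion.1 h
        exact ⟨n, Or.inl hn⟩
      · exact ⟨0, Or.inr h⟩
    have hm : Measurable fun ω => x (Nat.find (hex ω)) i ω :=
      Measurable.find (f := fun n ω => x n i ω) (p := fun n ω => ω ∈ A n ∨ ω ∉ ⋃ k, A k)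
        (fun n => (x n i).measurable)
        (fun n => (hA.measurableSet n).union (MeasurableSet.iUnion hA.measurableSet).compl) hex
    refine ⟨AEEqFun.mk _ hm.aestronglyMeasurable, fun k => ?_⟩
    have hd : ∀ᵐ ω ∂P, ∀ j, j ≠ k → ¬ (ω ∈ A j ∧ ω ∈ A k) := by
      refine ae_all_iff.2 fun j => ?_
      by_cases hj : j = k
      · exact Eventually.of_forall fun ω h => absurd hj h
      · filter_upwards [measure_eq_zero_iff_ae_notMem.1 (hA.aedisjoint hj)] with ω h _ h'
        exact h h'
    filter_upwards [AEEqFun.coeFn_mk _ hm.aestronglyMeasurable, hd] with ω h1 h2 hk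
    rw [h1]
    have h3 : Nat.find (hex ω) = k := by
      by_contra hne
      rcases Nat.find_spec (hex ω) with h | h
      · exact h2 _ hne ⟨h, hk⟩
      · exact h (Set.mem_iUnion.2 ⟨k, hk⟩)
    rw [h3]
  choose y hy using key
  refine ⟨y, fun k i => hy i k, fun z hz => ?_⟩
  funext i
  refine AEEqFun.ext ?_
  filter_upwards [hA.cover, ae_all_iff.2 fun k => hz k i, ae_all_iff.2 fun k => hy i k]
    with ω h1 h2 h3
  obtain ⟨k, hk⟩ := Set.mem_iUnion.1 h1
  rw [h2 k hk, h3 k hk]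

/-- A stable set: nonempty and closed under countable concatenations. -/
def IsStable (K : Set (L0d P d)) : Prop :=
  K.Nonempty ∧ ∀ A : ℕ → Set Ω, IsPartition P A →
    ∀ x : ℕ → L0d P d, (∀ k, x k ∈ K) → ∀ y, IsConcat A x y → y ∈ K

/-- The set `∑ₖ Y k | A k` of all concatenations along `(A k)` of elements `y k ∈ Y k`. -/
def setConcat (A : ℕ → Set Ω) (Y : ℕ → Set (L0d P d)) : Set (L0d P d) :=
  {y | ∃ x : ℕ → L0d P d, (∀ k, x k ∈ Y k) ∧ IsConcat A x y}

/-- A stable collection of stable sets. -/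
def IsStableCollection (B : Set (Set (L0d P d))) : Prop :=
  B.Nonempty ∧ (∀ Y ∈ B, IsStable Y) ∧
    ∀ A : ℕ → Set Ω, IsPartition P A →
      ∀ Y : ℕ → Set (L0d P d), (∀ k, Y k ∈ B) → setConcat A Y ∈ B

/-- The Euclidean `L⁰`-norm `(∑ᵢ xᵢ²)^{1/2}`. -/
noncomputable def l0norm (x : L0d P d) : L0 P :=
  AEEqFun.comp Real.sqrt Real.continuous_sqrt (∑ i, x i * x i)

/-- The ball `{y | ‖x - y‖ < r}`, with `<` almost everywhere. -/
def l0ball (x : L0d P d) (r : L0 P) : Set (L0d P d) :=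
  {y | ∀ᵐ ω ∂P, l0norm (x - y) ω < r ω}

/-- The topology on `(L⁰)^d` generated by the balls `l0ball x r` with `r > 0` almost everywhere. -/
@[reducible] def stableTopology (P : Measure Ω) (d : ℕ) : TopologicalSpace (L0d P d) :=
  TopologicalSpace.generateFrom
    {U | ∃ (x : L0d P d) (r : L0 P), (∀ᵐ ω ∂P, 0 < r ω) ∧ U = l0ball x r}

/-- A stable filter on `K`: it has a filter base which is a stable collection of stable subsets
of `K`. As with `IsCompact`, a filter on `K` is regarded as a filter on the ambient space that
contains `K`. -/
def IsStableFilterOn (K : Set (L0d P d)) (F : Filter (L0d P d)) : Prop :=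
  ∃ B : Set (Set (L0d P d)), IsStableCollection B ∧ (∀ Y ∈ B, Y ⊆ K) ∧
    F.HasBasis (fun Y => Y ∈ B) id

/-- `K` is stable compact: it is stable and every stable filter on `K` has a cluster point
in `K`. -/
def IsStableCompact (K : Set (L0d P d)) : Prop :=
  IsStable K ∧ ∀ F : Filter (L0d P d), IsStableFilterOn K F →
    ∃ x ∈ K, @ClusterPt _ (stableTopology P d) x F

/-- `K` is bounded: `sup {‖x₀ - x‖ | x ∈ K} < ∞` for some `x₀ ∈ K`, the supremum being taken in
the Dedekind complete lattice `L⁰`. -/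
def IsL0Bounded (K : Set (L0d P d)) : Prop :=
  ∃ x₀ ∈ K, BddAbove ((fun x => l0norm (x₀ - x)) '' K)

/-- `K` is closed under almost everywhere limits of sequences. -/
def IsAESeqClosed (K : Set (L0d P d)) : Prop :=
  ∀ x : ℕ → L0d P d, (∀ n, x n ∈ K) → ∀ y : L0d P d,
    (∀ᵐ ω ∂P, ∀ i, Tendsto (fun n => x n i ω) atTop (𝓝 (y i ω))) → y ∈ K

/-- A measurable multifunction `Ω ⇉ ℝ^d` with nonempty compact values; measurable means that
`{ω | S ω ∩ C ≠ ∅}` is measurable for every closed `C`. -/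
structure IsMeasurableCompactValued (S : Ω → Set (Fin d → ℝ)) : Prop where
  nonempty : ∀ ω, (S ω).Nonempty
  isCompact : ∀ ω, IsCompact (S ω)
  measurable : ∀ C : Set (Fin d → ℝ), IsClosed C → MeasurableSet {ω | (S ω ∩ C).Nonempty}

/-- The set of (equivalence classes of) measurable selectors of `S`. -/
def measurableSelectors (P : Measure Ω) (S : Ω → Set (Fin d → ℝ)) : Set (L0d P d) :=
  {x | ∃ f : Ω → Fin d → ℝ, Measurable f ∧ (∀ ω, f ω ∈ S ω) ∧
    ∀ i, ∀ᵐ ω ∂P, x i ω = f ω i}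

end StableL0

/-! Choose pointwise representatives. A countable partition becomes a measurable index `N : Ω → ℕ`,
and stability means that measurable choices among the terms of a sequence in the set stay in the
set. The key object is the multifunction `S_Y(ω)` attached to a bounded stable set `Y`: the closure
of the values at `ω` of a countable, almost everywhere dense subfamily of `Y`
(`exists_seq_ae_dense`). It has measurable compact values, contains every `y ∈ Y` almost everywhere,
and each of its selectors is approximated by elements of `Y` within any positive `r ∈ L⁰`
(`IsStable.exists_multifunction`). If `Y` is sequentially closed, it is therefore the set of
selectors of `S_Y`. The converse and uniqueness rest on measurable selection. For stable
compactness, `Y ↦ S_Y` turns the base of a stable filter into a directed family of compact-valued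
multifunctions. Exhaustion extracts a decreasing sequence with the same essential intersection;
compactness in `ℝ^d` makes that intersection nonempty, and a measurable selector of it is a cluster
point. Conversely, a stable compact set is tested on filters given by local conditions with a
positive parameter (`IsStableCompact.exists_clusterPt_of_local`): closeness to a point of the
closure yields closedness, large distance from a base point yields boundedness. -/

namespace StableL0

variable {Ω : Type*} [MeasurableSpace Ω] {P : Measure Ω} {d : ℕ}

/-! ### Representatives, partitions as measurable indices, measurable choice. -/

/-- The pointwise representative of an element of `(L⁰)^d`. -/
noncomputable def pt (x : L0d P d) (ω : Ω) : Fin d → ℝ := fun i => x i ω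

theorem measurable_pt (x : L0d P d) : Measurable (pt x) :=
  measurable_pi_lambda _ fun i => (x i).measurable

theorem measurable_pt_index (x : ℕ → L0d P d) {N : Ω → ℕ} (hN : Measurable N) :
    Measurable fun ω => pt (x (N ω)) ω :=
  (measurable_from_prod_countable_right (f := fun q : ℕ × Ω => pt (x q.1) q.2)
    fun n => measurable_pt (x n)).comp (hN.prodMk measurable_id)

theorem exists_pt_eq (P : Measure Ω) {f : Ω → Fin d → ℝ} (hf : Measurable f) :
    ∃ x : L0d P d, ∀ᵐ ω ∂P, pt x ω = f ω := by
  have hi : ∀ i, Measurable fun ω => f ω i := fun i => (measurable_pi_apply i).comp hf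
  refine ⟨fun i => AEEqFun.mk _ (hi i).aestronglyMeasurable, ?_⟩
  filter_upwards [ae_all_iff.2 fun i => AEEqFun.coeFn_mk _ (hi i).aestronglyMeasurable (μ := P)]
    with ω h
  funext i
  exact h i

theorem exists_L0_eq (P : Measure Ω) {f : Ω → ℝ} (hf : Measurable f) :
    ∃ r : L0 P, ∀ᵐ ω ∂P, r ω = f ω :=
  ⟨AEEqFun.mk f hf.aestronglyMeasurable, AEEqFun.coeFn_mk _ _⟩

theorem eq_of_pt_ae_eq {x y : L0d P d} (h : ∀ᵐ ω ∂P, pt x ω = pt y ω) : x = y := by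
  funext i
  refine AEEqFun.ext ?_
  filter_upwards [h] with ω hω
  exact congrFun hω i

theorem IsPartition.exists_index {A : ℕ → Set Ω} (hA : IsPartition P A) :
    ∃ N : Ω → ℕ, Measurable N ∧ ∀ᵐ ω ∂P, ∀ k, ω ∈ A k ↔ N ω = k := by
  classical
  -- The second alternative makes the search total on the null set that the partition misses.
  have hex : ∀ ω, ∃ n, ω ∈ A n ∨ ω ∉ ⋃ k, A k := by
    intro ω
    by_cases h : ω ∈ ⋃ k, A k
    · obtain ⟨n, hn⟩ := Set.mem_iUnion.1 h
      exact ⟨n, Or.inl hn⟩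
    · exact ⟨0, Or.inr h⟩
  refine ⟨fun ω => Nat.find (hex ω), measurable_find hex fun n =>
    (hA.measurableSet n).union (MeasurableSet.iUnion hA.measurableSet).compl, ?_⟩
  have hd : ∀ᵐ ω ∂P, ∀ j k, j ≠ k → ¬ (ω ∈ A j ∧ ω ∈ A k) := by
    refine ae_all_iff.2 fun j => ae_all_iff.2 fun k => ?_
    by_cases hj : j = k
    · exact Eventually.of_forall fun ω h => absurd hj h
    · filter_upwards [measure_eq_zero_iff_ae_notMem.1 (hA.aedisjoint hj)] with ω h _ h'
      exact h h'
  filter_upwards [hd, hA.cover] with ω h1 h2 k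
  have h3 : ω ∈ A (Nat.find (hex ω)) := (Nat.find_spec (hex ω)).resolve_right (not_not.2 h2)
  constructor
  · intro hk
    by_contra hne
    exact h1 _ _ hne ⟨h3, hk⟩
  · rintro rfl
    exact h3

theorem isPartition_preimage (P : Measure Ω) {N : Ω → ℕ} (hN : Measurable N) :
    IsPartition P fun k => N ⁻¹' {k} where
  measurableSet k := hN (measurableSet_singleton k)
  aedisjoint j k hjk := by
    refine Disjoint.aedisjoint (Set.disjoint_left.2 ?_)
    rintro ω rfl h
    exact hjk h
  cover := Eventually.of_forall fun ω => Set.mem_iUnion.2 ⟨N ω, rfl⟩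

theorem isConcat_iff {A : ℕ → Set Ω} {N : Ω → ℕ} (h : ∀ᵐ ω ∂P, ∀ k, ω ∈ A k ↔ N ω = k)
    {x : ℕ → L0d P d} {y : L0d P d} :
    IsConcat A x y ↔ ∀ᵐ ω ∂P, pt y ω = pt (x (N ω)) ω := by
  constructor
  · intro hy
    filter_upwards [h, ae_all_iff.2 fun k => ae_all_iff.2 fun i => hy k i] with ω h1 h2
    funext i
    exact h2 _ i ((h1 _).2 rfl)
  · intro hy k i
    filter_upwards [h, hy] with ω h1 h2 hk
    have := congrFun h2 i
    rwa [(h1 k).1 hk] at this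

theorem isStable_iff {K : Set (L0d P d)} :
    IsStable K ↔ K.Nonempty ∧ ∀ N : Ω → ℕ, Measurable N → ∀ x : ℕ → L0d P d, (∀ k, x k ∈ K) →
      ∀ y, (∀ᵐ ω ∂P, pt y ω = pt (x (N ω)) ω) → y ∈ K := by
  refine and_congr_right fun _ => ⟨fun h N hN x hx y hy => ?_, fun h A hA x hx y hy => ?_⟩
  · exact h _ (isPartition_preimage P hN) x hx y
      ((isConcat_iff (Eventually.of_forall fun ω k => Iff.rfl)).2 hy)
  · obtain ⟨N, hN, hAN⟩ := hA.exists_index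
    exact h N hN x hx y ((isConcat_iff hAN).1 hy)

/-- Measurable choice among the members of a sequence in a stable set. -/
theorem IsStable.exists_select {K : Set (L0d P d)} (hK : IsStable K) {x : ℕ → L0d P d}
    (hx : ∀ n, x n ∈ K) {p : ℕ → Ω → Prop} (hp : ∀ n, MeasurableSet {ω | p n ω})
    (hex : ∀ᵐ ω ∂P, ∃ n, p n ω) :
    ∃ z ∈ K, ∀ᵐ ω ∂P, ∃ n, p n ω ∧ pt z ω = pt (x n) ω := by
  classical
  have hex' : ∀ ω, ∃ n, p n ω ∨ ∀ m, ¬ p m ω := by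
    intro ω
    by_cases h : ∃ n, p n ω
    · exact h.imp fun n hn => Or.inl hn
    · exact ⟨0, Or.inr (not_exists.1 h)⟩
  have hN : Measurable fun ω => Nat.find (hex' ω) := measurable_find hex' fun n => by
    simp only [Set.ofPred_or, Set.ofPred_forall]
    exact (hp n).union (MeasurableSet.iInter fun m => (hp m).compl)
  obtain ⟨z, hz⟩ := exists_pt_eq P (measurable_pt_index x hN)
  refine ⟨z, (isStable_iff.1 hK).2 _ hN x hx z hz, ?_⟩
  filter_upwards [hz, hex] with ω h1 h2
  exact ⟨_, (Nat.find_spec (hex' ω)).resolve_right fun h => h2.elim h, h1⟩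

/-! ### Exhaustion and countable dense subfamilies. -/

/-- A family of measurable sets has a countable subfamily with the same essential union. -/
theorem exists_seq_ae_cover (P : Measure Ω) [IsFiniteMeasure P] {ι : Type*} [Nonempty ι]
    {E : ι → Set Ω} (hE : ∀ i, MeasurableSet (E i)) :
    ∃ u : ℕ → ι, ∀ i, ∀ᵐ ω ∂P, ω ∈ E i → ∃ n, ω ∈ E (u n) := by
  obtain ⟨v, -, hv, hvr⟩ := exists_seq_tendsto_sSup
    (S := Set.range fun u : ℕ → ι => P (⋃ n, E (u n))) (Set.range_nonempty _) (OrderTop.bddAbove _)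
  choose w hw using hvr
  obtain ⟨e, he⟩ := exists_surjective_nat (ℕ × ℕ)
  let u : ℕ → ι := fun n => w (e n).1 (e n).2
  have hu : ∀ k, v k ≤ P (⋃ n, E (u n)) := fun k => by
    rw [← hw k]
    refine measure_mono (Set.iUnion_subset fun n => ?_)
    obtain ⟨m, hm⟩ := he (k, n)
    refine Set.subset_iUnion_of_subset m ?_
    simp [u, hm]
  refine ⟨u, fun i => ?_⟩
  -- The union along `u` already attains the supremum of measures, so prepending `i` can add only a
  -- null set.
  have hle : P (⋃ n, E (Nat.casesOn n i u)) ≤ P (⋃ n, E (u n)) :=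
    (le_sSup (Set.mem_range_self (f := fun u : ℕ → ι => P (⋃ n, E (u n)))
      fun n => Nat.casesOn n i u)).trans (le_of_tendsto' hv hu)
  have hsub : (⋃ n, E (u n)) ⊆ ⋃ n, E (Nat.casesOn n i u) :=
    Set.iUnion_subset fun n =>
      Set.subset_iUnion (fun n : ℕ => E (Nat.casesOn n i u : ι)) (n + 1)
  have hae := ae_eq_of_subset_of_measure_ge hsub hle
    (MeasurableSet.iUnion fun n => hE (u n)).nullMeasurableSet (measure_ne_top P _)
  filter_upwards [hae.mem_iff] with ω h hi
  exact Set.mem_iUnion.1 (h.2 (Set.mem_iUnion.2 ⟨0, hi⟩))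

/-- A countable family of closed balls containing arbitrarily small neighbourhoods of each
point. -/
noncomputable def gridBall (d : ℕ) (j : ℕ × ℕ) : Set (Fin d → ℝ) :=
  Metric.closedBall (TopologicalSpace.denseSeq (Fin d → ℝ) j.1) (1 / (j.2 + 1))

theorem isClosed_gridBall (j : ℕ × ℕ) : IsClosed (gridBall d j) := Metric.isClosed_closedBall

theorem mem_of_forall_gridBall {T : Set (Fin d → ℝ)} (hT : IsClosed T) {v : Fin d → ℝ}
    (h : ∀ j, v ∈ gridBall d j → (T ∩ gridBall d j).Nonempty) : v ∈ T := by
  rw [← hT.closure_eq]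
  refine Metric.mem_closure_iff.2 fun ε hε => ?_
  obtain ⟨m, hm⟩ := exists_nat_one_div_lt (half_pos hε)
  obtain ⟨i, hi⟩ := (TopologicalSpace.denseRange_denseSeq (Fin d → ℝ)).exists_dist_lt v
    (Nat.one_div_pos_of_nat (n := m) (α := ℝ))
  obtain ⟨w, hw, hwB⟩ := h (i, m) (Metric.mem_closedBall.2 hi.le)
  refine ⟨w, hw, ?_⟩
  have h1 := dist_triangle_right v w (TopologicalSpace.denseSeq (Fin d → ℝ) i)
  have h2 := Metric.mem_closedBall.1 hwB
  dsimp only at h2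
  linarith

theorem exists_seq_ae_dense [IsFiniteMeasure P] {K : Set (L0d P d)} (hK : K.Nonempty) :
    ∃ u : ℕ → L0d P d, (∀ n, u n ∈ K) ∧
      ∀ x ∈ K, ∀ᵐ ω ∂P, pt x ω ∈ closure (Set.range fun n => pt (u n) ω) := by
  have : Nonempty K := hK.to_subtype
  have key : ∀ j, ∃ u : ℕ → K, ∀ x : K, ∀ᵐ ω ∂P,
      pt x.1 ω ∈ gridBall d j → ∃ n, pt (u n).1 ω ∈ gridBall d j :=
    fun j => exists_seq_ae_cover P (E := fun x : K => {ω | pt x.1 ω ∈ gridBall d j})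
      fun x => measurable_pt x.1 (isClosed_gridBall j).measurableSet
  choose u hu using key
  obtain ⟨e, he⟩ := exists_surjective_nat ((ℕ × ℕ) × ℕ)
  refine ⟨fun n => u (e n).1 (e n).2, fun n => (u (e n).1 (e n).2).2, fun x hx => ?_⟩
  filter_upwards [ae_all_iff.2 fun j => hu j ⟨x, hx⟩] with ω h
  refine mem_of_forall_gridBall isClosed_closure fun j hj => ?_
  obtain ⟨n, hn⟩ := h j hj
  obtain ⟨k, hk⟩ := he (j, n)
  exact ⟨_, subset_closure ⟨k, by simp only [hk]⟩, hn⟩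

/-! ### Measurable compact-valued multifunctions and their selectors. -/

theorem IsMeasurableCompactValued.argmin {S : Ω → Set (Fin d → ℝ)}
    (hS : IsMeasurableCompactValued S) {g : (Fin d → ℝ) → ℝ} (hg : Continuous g) :
    IsMeasurableCompactValued fun ω => {v ∈ S ω | ∀ w ∈ S ω, g v ≤ g w} where
  nonempty ω := (hS.isCompact ω).exists_isMinOn (hS.nonempty ω) hg.continuousOn
  isCompact ω := by
    have : {v ∈ S ω | ∀ w ∈ S ω, g v ≤ g w} = S ω ∩ ⋂ w ∈ S ω, {v | g v ≤ g w} := by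
      ext v; simp
    rw [this]
    exact (hS.isCompact ω).inter_right
      (isClosed_biInter fun w _ => isClosed_le hg continuous_const)
  measurable C hC := by
    have hle : ∀ q : ℚ, IsClosed {v | g v ≤ q} := fun q => isClosed_le hg continuous_const
    -- A minimiser over `S ω` lies in `C` exactly when `S ω ∩ C` is nonempty and reaches every
    -- rational level that `S ω` reaches.
    have : {ω | ({v ∈ S ω | ∀ w ∈ S ω, g v ≤ g w} ∩ C).Nonempty} =
        {ω | (S ω ∩ C).Nonempty} ∩ ⋂ q : ℚ, ({ω | (S ω ∩ {v | g v ≤ q}).Nonempty}ᶜ ∪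
          {ω | (S ω ∩ (C ∩ {v | g v ≤ q})).Nonempty}) := by
      ext ω
      simp only [Set.mem_inter_iff, Set.mem_iInter, Set.mem_union, Set.mem_compl_iff,
        Set.mem_ofPred_eq, ← imp_iff_not_or]
      constructor
      · rintro ⟨v, ⟨hv, hmin⟩, hvC⟩
        exact ⟨⟨v, hv, hvC⟩, fun q ⟨w, hw, hwq⟩ => ⟨v, hv, hvC, (hmin w hw).trans hwq⟩⟩
      · rintro ⟨hne, hq⟩
        obtain ⟨v, hv, hmin⟩ :=
          ((hS.isCompact ω).inter_right hC).exists_isMinOn hne hg.continuousOn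
        refine ⟨v, ⟨hv.1, fun w hw => ?_⟩, hv.2⟩
        by_contra! hlt
        obtain ⟨q, hq1, hq2⟩ := exists_rat_btwn hlt
        obtain ⟨u, hu, huC, huq⟩ := hq q ⟨w, hw, hq1.le⟩
        exact absurd ((hmin ⟨hu, huC⟩ : g v ≤ g u).trans huq) (not_le.2 hq2)
    rw [this]
    exact (hS.measurable C hC).inter (MeasurableSet.iInter fun q =>
      (hS.measurable _ (hle q)).compl.union (hS.measurable _ (hC.inter (hle q))))

/-- Minimising the coordinates one after another leaves a single point in each value; measurability
of a single-valued multifunction is that of the function. -/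
theorem IsMeasurableCompactValued.exists_selector {S : Ω → Set (Fin d → ℝ)}
    (hS : IsMeasurableCompactValued S) : ∃ f : Ω → Fin d → ℝ, Measurable f ∧ ∀ ω, f ω ∈ S ω := by
  classical
  have key : ∀ s : Finset (Fin d), ∃ T : Ω → Set (Fin d → ℝ), IsMeasurableCompactValued T ∧
      (∀ ω, T ω ⊆ S ω) ∧ ∀ ω, ∀ u ∈ T ω, ∀ v ∈ T ω, ∀ i ∈ s, u i = v i := by
    intro s
    induction s using Finset.induction_on with
    | empty => exact ⟨S, hS, fun ω => subset_rfl, by simp⟩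
    | insert a s _ ih =>
      obtain ⟨T, hT, hTS, hTs⟩ := ih
      refine ⟨_, hT.argmin (continuous_apply a), fun ω v hv => hTS ω hv.1, ?_⟩
      intro ω u hu v hv i hi
      rcases Finset.mem_insert.1 hi with rfl | hi
      · exact le_antisymm (hu.2 v hv.1) (hv.2 u hu.1)
      · exact hTs ω u hu.1 v hv.1 i hi
  obtain ⟨T, hT, hTS, hTs⟩ := key Finset.univ
  choose f hf using hT.nonempty
  refine ⟨f, measurable_of_isClosed fun C hC => ?_, fun ω => hTS ω (hf ω)⟩
  convert hT.measurable C hC using 1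
  ext ω
  refine ⟨fun h => ⟨f ω, hf ω, h⟩, fun ⟨v, hv, hvC⟩ => ?_⟩
  have : f ω = v := funext fun i => hTs ω _ (hf ω) _ hv i (Finset.mem_univ i)
  rwa [Set.mem_preimage, this]

theorem IsMeasurableCompactValued.ite {S T : Ω → Set (Fin d → ℝ)}
    (hS : IsMeasurableCompactValued S) (hT : IsMeasurableCompactValued T) {G : Set Ω}
    (hG : MeasurableSet G) [∀ ω, Decidable (ω ∈ G)] :
    IsMeasurableCompactValued fun ω => if ω ∈ G then S ω else T ω where
  nonempty ω := by split_ifs; exacts [hS.nonempty ω, hT.nonempty ω]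
  isCompact ω := by split_ifs; exacts [hS.isCompact ω, hT.isCompact ω]
  measurable C hC := by
    convert hG.ite (hS.measurable C hC) (hT.measurable C hC) using 1
    ext ω
    by_cases h : ω ∈ G <;> simp [Set.ite, h]

theorem isMeasurableCompactValued_singleton_zero :
    IsMeasurableCompactValued fun _ : Ω => ({0} : Set (Fin d → ℝ)) where
  nonempty _ := Set.singleton_nonempty _
  isCompact _ := isCompact_singleton
  measurable _ _ := MeasurableSet.const _

theorem mem_measurableSelectors_iff {S : Ω → Set (Fin d → ℝ)}
    (hS : IsMeasurableCompactValued S) {x : L0d P d} :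
    x ∈ measurableSelectors P S ↔ ∀ᵐ ω ∂P, pt x ω ∈ S ω := by
  classical
  constructor
  · rintro ⟨f, -, hfS, hx⟩
    filter_upwards [ae_all_iff.2 hx] with ω h
    rw [show pt x ω = f ω from funext h]
    exact hfS ω
  · intro h
    obtain ⟨f, hf, hfS⟩ := hS.exists_selector
    obtain ⟨G, hG, hGm, hGS⟩ := h.exists_measurable_mem
    refine ⟨fun ω => if ω ∈ G then pt x ω else f ω, (measurable_pt x).ite hGm hf, fun ω => ?_,
      fun i => ?_⟩
    · dsimp only
      split_ifs with hω
      exacts [hGS ω hω, hfS ω]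
    · filter_upwards [hG] with ω hω
      simp [hω, pt]

/-- A measurable multifunction is determined by its measurable selectors. -/
theorem IsMeasurableCompactValued.ae_subset {S T : Ω → Set (Fin d → ℝ)}
    (hS : IsMeasurableCompactValued S) (hT : ∀ ω, IsClosed (T ω))
    (h : ∀ x : L0d P d, (∀ᵐ ω ∂P, pt x ω ∈ S ω) → ∀ᵐ ω ∂P, pt x ω ∈ T ω) :
    ∀ᵐ ω ∂P, S ω ⊆ T ω := by
  classical
  have key : ∀ j, ∀ᵐ ω ∂P, (S ω ∩ gridBall d j).Nonempty → (T ω ∩ gridBall d j).Nonempty := by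
    intro j
    set B := gridBall d j
    have hB : IsClosed B := isClosed_gridBall j
    -- A selector of this modification enters `B` wherever `S` allows it.
    have hR : IsMeasurableCompactValued fun ω => if (S ω ∩ B).Nonempty then S ω ∩ B else S ω := by
      refine ⟨fun ω => ?_, fun ω => ?_, fun C hC => ?_⟩
      · split_ifs with hne
        exacts [hne, hS.nonempty ω]
      · split_ifs
        exacts [(hS.isCompact ω).inter_right hB, hS.isCompact ω]
      · convert (hS.measurable B hB).ite (hS.measurable _ (hB.inter hC)) (hS.measurable C hC) using 1
        ext ω
        by_cases hω : (S ω ∩ B).Nonempty <;> simp [Set.ite, hω, Set.inter_assoc]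
    obtain ⟨f, hf, hfR⟩ := hR.exists_selector
    obtain ⟨x, hx⟩ := exists_pt_eq P hf
    have hxS : ∀ᵐ ω ∂P, pt x ω ∈ S ω := by
      filter_upwards [hx] with ω hω
      rw [hω]
      have := hfR ω
      split_ifs at this
      exacts [this.1, this]
    filter_upwards [hx, h x hxS] with ω h1 h2 hne
    have := hfR ω
    rw [if_pos hne, ← h1] at this
    exact ⟨_, h2, this.2⟩
  filter_upwards [ae_all_iff.2 key] with ω hω v hv
  exact mem_of_forall_gridBall (hT ω) fun j hj => hω j ⟨v, hv, hj⟩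

theorem IsMeasurableCompactValued.iInter {S : ℕ → Ω → Set (Fin d → ℝ)}
    (hS : ∀ n, IsMeasurableCompactValued (S n)) (hanti : ∀ ω n, S (n + 1) ω ⊆ S n ω) :
    IsMeasurableCompactValued fun ω => ⋂ n, S n ω where
  nonempty ω := IsCompact.nonempty_iInter_of_sequence_nonempty_isCompact_isClosed _ (hanti ω)
    (fun n => (hS n).nonempty ω) ((hS 0).isCompact ω) fun n => ((hS n).isCompact ω).isClosed
  isCompact ω := ((hS 0).isCompact ω).of_isClosed_subset
    (isClosed_iInter fun n => ((hS n).isCompact ω).isClosed) (Set.iInter_subset _ 0)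
  measurable C hC := by
    have : {ω | ((⋂ n, S n ω) ∩ C).Nonempty} = ⋂ n, {ω | (S n ω ∩ C).Nonempty} := by
      ext ω
      rw [Set.mem_iInter]
      constructor
      · exact fun ⟨v, hv, hvC⟩ n => ⟨v, Set.mem_iInter.1 hv n, hvC⟩
      · intro h
        change ((⋂ n, S n ω) ∩ C).Nonempty
        rw [Set.iInter_inter]
        exact IsCompact.nonempty_iInter_of_sequence_nonempty_isCompact_isClosed _
          (fun n => Set.inter_subset_inter_left _ (hanti ω n)) h
          (((hS 0).isCompact ω).inter_right hC) fun n => ((hS n).isCompact ω).isClosed.inter hC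
    rw [this]
    exact MeasurableSet.iInter fun n => (hS n).measurable C hC

/-- The pointwise closure of a sequence of measurable functions. -/
theorem isMeasurableCompactValued_closure_range {u : ℕ → Ω → Fin d → ℝ}
    (hu : ∀ n, Measurable (u n)) (hb : ∀ ω, Bornology.IsBounded (Set.range fun n => u n ω)) :
    IsMeasurableCompactValued fun ω => closure (Set.range fun n => u n ω) where
  nonempty ω := (Set.range_nonempty _).closure
  isCompact ω := (hb ω).isCompact_closure
  measurable C hC := by
    rcases C.eq_empty_or_nonempty with rfl | hne
    · simp
    -- By compactness, the closure meets `C` as soon as the distances from the sequence to `C` have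
    -- infimum zero.
    have : {ω | (closure (Set.range fun n => u n ω) ∩ C).Nonempty} =
        ⋂ m : ℕ, ⋃ n, {ω | Metric.infDist (u n ω) C < 1 / (m + 1)} := by
      ext ω
      simp only [Set.mem_iInter, Set.mem_iUnion, Set.mem_ofPred_eq]
      constructor
      · rintro ⟨v, hv, hvC⟩ m
        obtain ⟨_, ⟨n, rfl⟩, hn⟩ := Metric.mem_closure_iff.1 hv _
          (Nat.one_div_pos_of_nat (n := m) (α := ℝ))
        refine ⟨n, (Metric.infDist_le_dist_of_mem hvC).trans_lt ?_⟩
        rwa [dist_comm]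
      · intro h
        obtain ⟨v, hv, hmin⟩ := (hb ω).isCompact_closure.exists_isMinOn
          (Set.range_nonempty _).closure (Metric.continuous_infDist_pt C).continuousOn
        refine ⟨v, hv, (hC.mem_iff_infDist_zero hne).2 ?_⟩
        refine le_antisymm (le_of_forall_pos_lt_add fun ε hε => ?_) Metric.infDist_nonneg
        obtain ⟨m, hm⟩ := exists_nat_one_div_lt hε
        obtain ⟨n, hn⟩ := h m
        have : Metric.infDist v C ≤ Metric.infDist (u n ω) C := hmin (subset_closure ⟨n, rfl⟩)
        linarith
    rw [this]
    exact MeasurableSet.iInter fun m => MeasurableSet.iUnion fun n =>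
      measurableSet_lt ((hu n).infDist) measurable_const

/-! ### From bounded stable sets to multifunctions. -/

/-- The multifunction spanned by a bounded stable set. -/
theorem IsStable.exists_multifunction [IsFiniteMeasure P] {Y : Set (L0d P d)} (hY : IsStable Y)
    {c : L0d P d} {M : Ω → ℝ} (hM : ∀ y ∈ Y, ∀ᵐ ω ∂P, dist (pt y ω) (pt c ω) ≤ M ω) :
    ∃ S : Ω → Set (Fin d → ℝ), IsMeasurableCompactValued S ∧
      (∀ y ∈ Y, ∀ᵐ ω ∂P, pt y ω ∈ S ω) ∧
      ∀ x : L0d P d, (∀ᵐ ω ∂P, pt x ω ∈ S ω) → ∀ r : L0 P, (∀ᵐ ω ∂P, 0 < r ω) →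
        ∃ y ∈ Y, ∀ᵐ ω ∂P, dist (pt y ω) (pt x ω) < r ω := by
  classical
  obtain ⟨u, huY, hu⟩ := exists_seq_ae_dense hY.1
  obtain ⟨G, hG, hGm, hGM⟩ :=
    (ae_all_iff.2 fun n => hM (u n) (huY n)).exists_measurable_mem
  -- The value `0` off `G` gives boundedness at every `ω`, not just almost every one.
  let v : ℕ → Ω → Fin d → ℝ := fun n ω => if ω ∈ G then pt (u n) ω else 0
  have hv : ∀ n, Measurable (v n) := fun n => (measurable_pt _).ite hGm measurable_const
  have hvG : ∀ ω ∈ G, ∀ n, v n ω = pt (u n) ω := fun ω hω n => if_pos hω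
  refine ⟨fun ω => closure (Set.range fun n => v n ω),
    isMeasurableCompactValued_closure_range hv fun ω => ?_, fun y hy => ?_, fun x hx r hr => ?_⟩
  · by_cases hω : ω ∈ G
    · refine (Metric.isBounded_closedBall (x := pt c ω) (r := M ω)).subset ?_
      rintro _ ⟨n, rfl⟩
      simp only [hvG ω hω]
      exact hGM ω hω n
    · refine (Bornology.isBounded_singleton (x := (0 : Fin d → ℝ))).subset ?_
      rintro _ ⟨n, rfl⟩
      simp [v, hω]
  · filter_upwards [hG, hu y hy] with ω h1 h2
    simpa only [hvG ω h1] using h2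
  · obtain ⟨z, hz, hzx⟩ := hY.exists_select huY
      (p := fun n ω => dist (pt (u n) ω) (pt x ω) < r ω)
      (fun n => measurableSet_lt ((measurable_pt _).dist (measurable_pt _)) r.measurable) (by
        filter_upwards [hG, hx, hr] with ω h1 h2 h3
        obtain ⟨_, ⟨n, rfl⟩, hn⟩ := Metric.mem_closure_iff.1 h2 _ h3
        refine ⟨n, ?_⟩
        rwa [dist_comm, ← hvG ω h1])
    refine ⟨z, hz, ?_⟩
    filter_upwards [hzx] with ω ⟨n, h1, h2⟩
    rwa [h2]

/-! ### Norm, topology and boundedness through the pointwise sup distance. -/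

theorem l0norm_sub_ae_eq (x y : L0d P d) :
    ∀ᵐ ω ∂P, l0norm (x - y) ω = dist (WithLp.toLp 2 (pt x ω)) (WithLp.toLp 2 (pt y ω)) := by
  have hsum : ∀ s : Finset (Fin d), ∀ᵐ ω ∂P, (∑ i ∈ s, (x - y) i * (x - y) i : L0 P) ω =
      ∑ i ∈ s, (x i ω - y i ω) ^ 2 := by
    classical
    intro s
    induction s using Finset.induction_on with
    | empty =>
      filter_upwards [AEEqFun.coeFn_zero (μ := P) (α := Ω) (β := ℝ)] with ω h
      simp [h]
    | insert a s ha ih =>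
      rw [Finset.sum_insert ha]
      filter_upwards [ih, AEEqFun.coeFn_add ((x - y) a * (x - y) a)
        (∑ i ∈ s, (x - y) i * (x - y) i), AEEqFun.coeFn_mul ((x - y) a) ((x - y) a),
        AEEqFun.coeFn_sub (x a) (y a)] with ω h1 h2 h3 h4
      rw [h2, Pi.add_apply, h1, h3, Pi.mul_apply, Finset.sum_insert ha, Pi.sub_apply, h4,
        Pi.sub_apply, sq]
  filter_upwards [hsum Finset.univ, AEEqFun.coeFn_comp Real.sqrt Real.continuous_sqrt
    (∑ i, (x - y) i * (x - y) i)] with ω h1 h2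
  rw [l0norm, h2, Function.comp_apply, h1, EuclideanSpace.dist_eq]
  simp [Real.dist_eq, sq_abs, pt]

theorem dist_le_dist_toLp (v w : Fin d → ℝ) :
    dist v w ≤ dist (WithLp.toLp 2 v) (WithLp.toLp 2 w) := by
  refine (dist_pi_le_iff dist_nonneg).2 fun i => ?_
  rw [EuclideanSpace.dist_eq]
  refine Real.le_sqrt_of_sq_le ?_
  exact Finset.single_le_sum (f := fun i => dist (v i) (w i) ^ 2) (fun j _ => sq_nonneg _)
    (Finset.mem_univ i)

/-- The sharp constant is `√d`; `d + 1` dominates it and stays positive when `d = 0`, so radii can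
be divided by it. -/
theorem dist_toLp_le (v w : Fin d → ℝ) :
    dist (WithLp.toLp 2 v) (WithLp.toLp 2 w) ≤ (d + 1) * dist v w := by
  rw [EuclideanSpace.dist_eq]
  refine Real.sqrt_le_iff.2 ⟨by positivity, ?_⟩
  have h : ∑ i, dist (v i) (w i) ^ 2 ≤ ∑ _i : Fin d, dist v w ^ 2 :=
    Finset.sum_le_sum fun i _ => pow_le_pow_left₀ dist_nonneg (dist_le_pi_dist v w i) 2
  refine h.trans ?_
  rw [Finset.sum_const, Finset.card_univ, Fintype.card_fin, nsmul_eq_mul, mul_pow]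
  have : (d : ℝ) ≤ ((d : ℝ) + 1) ^ 2 := by nlinarith [(Nat.cast_nonneg d : (0 : ℝ) ≤ d)]
  gcongr

theorem exists_l0ball_subset_of_isOpen {U : Set (L0d P d)}
    (hU : IsOpen[stableTopology P d] U) {x : L0d P d} (hx : x ∈ U) :
    ∃ r : L0 P, (∀ᵐ ω ∂P, 0 < r ω) ∧ l0ball x r ⊆ U := by
  induction hU with
  | basic s hs =>
    obtain ⟨c, r, hr, rfl⟩ := hs
    refine ⟨r - l0norm (c - x), ?_, fun y hy => ?_⟩
    · filter_upwards [AEEqFun.coeFn_sub r (l0norm (c - x)), hx] with ω h1 h2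
      rw [h1, Pi.sub_apply]
      linarith
    · filter_upwards [AEEqFun.coeFn_sub r (l0norm (c - x)), hy, l0norm_sub_ae_eq c x,
        l0norm_sub_ae_eq x y, l0norm_sub_ae_eq c y] with ω h1 h2 h3 h4 h5
      rw [h1, Pi.sub_apply, h3, h4] at h2
      rw [h5]
      linarith [dist_triangle (WithLp.toLp 2 (pt c ω)) (WithLp.toLp 2 (pt x ω))
        (WithLp.toLp 2 (pt y ω))]
  | univ =>
    refine ⟨1, ?_, Set.subset_univ _⟩
    filter_upwards [AEEqFun.coeFn_one (μ := P) (α := Ω) (β := ℝ)] with ω h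
    simp [h]
  | inter s t _ _ ihs iht =>
    obtain ⟨r, hr, hrs⟩ := ihs hx.1
    obtain ⟨q, hq, hqt⟩ := iht hx.2
    refine ⟨r ⊓ q, ?_, fun y hy => ⟨hrs ?_, hqt ?_⟩⟩
    · filter_upwards [hr, hq, AEEqFun.coeFn_inf r q] with ω h1 h2 h3
      rw [h3]
      exact lt_min h1 h2
    · filter_upwards [hy, AEEqFun.coeFn_inf r q] with ω h1 h2
      exact h1.trans_le (h2.le.trans inf_le_left)
    · filter_upwards [hy, AEEqFun.coeFn_inf r q] with ω h1 h2
      exact h1.trans_le (h2.le.trans inf_le_right)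
  | sUnion 𝒰 _ ih =>
    obtain ⟨V, hV, hxV⟩ := hx
    obtain ⟨r, hr, h⟩ := ih V hV hxV
    exact ⟨r, hr, h.trans (Set.subset_sUnion_of_mem hV)⟩

theorem mem_closure_iff_dist {Y : Set (L0d P d)} {x : L0d P d} :
    x ∈ @closure _ (stableTopology P d) Y ↔ ∀ r : L0 P, (∀ᵐ ω ∂P, 0 < r ω) →
      ∃ y ∈ Y, ∀ᵐ ω ∂P, dist (pt y ω) (pt x ω) < r ω := by
  rw [@_root_.mem_closure_iff _ (stableTopology P d)]
  constructor
  · intro h r hr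
    obtain ⟨y, hyr, hy⟩ := h (l0ball x r) (TopologicalSpace.GenerateOpen.basic _ ⟨x, r, hr, rfl⟩) (by
      filter_upwards [hr, l0norm_sub_ae_eq x x] with ω h1 h2
      rwa [h2, dist_self])
    refine ⟨y, hy, ?_⟩
    filter_upwards [hyr, l0norm_sub_ae_eq x y] with ω h1 h2
    rw [h2] at h1
    rw [dist_comm]
    exact (dist_le_dist_toLp _ _).trans_lt h1
  · intro h U hU hx
    obtain ⟨r, hr, hrU⟩ := exists_l0ball_subset_of_isOpen hU hx
    obtain ⟨q, hq⟩ := exists_L0_eq P (f := fun ω => r ω / (d + 1)) (r.measurable.div_const _)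
    obtain ⟨y, hy, hyq⟩ := h q (by
      filter_upwards [hr, hq] with ω h1 h2
      rw [h2]
      positivity)
    refine ⟨y, hrU ?_, hy⟩
    filter_upwards [hyq, hq, l0norm_sub_ae_eq x y] with ω h1 h2 h3
    rw [h2, dist_comm, lt_div_iff₀ (by positivity), mul_comm] at h1
    rw [h3]
    exact (dist_toLp_le _ _).trans_lt h1

theorem isL0Bounded_iff {K : Set (L0d P d)} :
    IsL0Bounded K ↔ ∃ x₀ ∈ K, ∃ M : Ω → ℝ, Measurable M ∧
      ∀ x ∈ K, ∀ᵐ ω ∂P, dist (pt x ω) (pt x₀ ω) ≤ M ω := by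
  refine exists_congr fun x₀ => and_congr_right fun _ => ⟨?_, ?_⟩
  · rintro ⟨M, hM⟩
    refine ⟨M, M.measurable, fun x hx => ?_⟩
    filter_upwards [AEEqFun.coeFn_le.2 (hM ⟨x, hx, rfl⟩), l0norm_sub_ae_eq x₀ x] with ω h1 h2
    rw [h2] at h1
    rw [dist_comm]
    exact (dist_le_dist_toLp _ _).trans h1
  · rintro ⟨M, hM, h⟩
    obtain ⟨q, hq⟩ := exists_L0_eq P (f := fun ω => (d + 1) * M ω) (hM.const_mul _)
    refine ⟨q, ?_⟩
    rintro _ ⟨x, hx, rfl⟩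
    refine AEEqFun.coeFn_le.1 ?_
    filter_upwards [h x hx, hq, l0norm_sub_ae_eq x₀ x] with ω h1 h2 h3
    rw [h2, h3]
    rw [dist_comm] at h1
    exact (dist_toLp_le _ _).trans (by gcongr)

theorem clusterPt_iff_dist {B : Set (Set (L0d P d))} {F : Filter (L0d P d)}
    (hF : F.HasBasis (fun Y => Y ∈ B) id) {x : L0d P d} :
    @ClusterPt _ (stableTopology P d) x F ↔ ∀ Y ∈ B, ∀ r : L0 P, (∀ᵐ ω ∂P, 0 < r ω) →
      ∃ y ∈ Y, ∀ᵐ ω ∂P, dist (pt y ω) (pt x ω) < r ω := by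
  let _ := stableTopology P d
  rw [hF.clusterPt_iff_forall_mem_closure]
  exact forall₂_congr fun Y _ => mem_closure_iff_dist

/-! ### Closed versus sequentially closed. -/

/-- Stable closed sets are closed under almost everywhere limits of sequences. -/
theorem IsStable.isAESeqClosed {K : Set (L0d P d)} (hK : IsStable K)
    (hc : IsClosed[stableTopology P d] K) : IsAESeqClosed K := by
  intro x hx y hy
  rw [← @IsClosed.closure_eq _ (stableTopology P d) _ hc]
  refine mem_closure_iff_dist.2 fun r hr => ?_
  obtain ⟨z, hz, hzx⟩ := hK.exists_select hx
    (p := fun n ω => dist (pt (x n) ω) (pt y ω) < r ω)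
    (fun n => measurableSet_lt ((measurable_pt _).dist (measurable_pt _)) r.measurable) (by
      filter_upwards [hy, hr] with ω h1 h2
      have : Tendsto (fun n => pt (x n) ω) atTop (𝓝 (pt y ω)) := tendsto_pi_nhds.2 h1
      exact (Metric.tendsto_nhds.1 this _ h2).exists)
  refine ⟨z, hz, ?_⟩
  filter_upwards [hzx] with ω ⟨n, h1, h2⟩
  rwa [h2]

theorem IsAESeqClosed.mem_of_approx {K : Set (L0d P d)} (hK : IsAESeqClosed K) {x : L0d P d}
    (hx : ∀ r : L0 P, (∀ᵐ ω ∂P, 0 < r ω) → ∃ y ∈ K, ∀ᵐ ω ∂P, dist (pt y ω) (pt x ω) < r ω) :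
    x ∈ K := by
  have key : ∀ n : ℕ, ∃ y ∈ K, ∀ᵐ ω ∂P, dist (pt y ω) (pt x ω) < 1 / (n + 1) := by
    intro n
    obtain ⟨q, hq⟩ := exists_L0_eq P (f := fun _ => 1 / ((n : ℝ) + 1)) measurable_const
    obtain ⟨y, hy, h⟩ := hx q (by
      filter_upwards [hq] with ω h
      rw [h]
      positivity)
    refine ⟨y, hy, ?_⟩
    filter_upwards [h, hq] with ω h1 h2
    rwa [h2] at h1
  choose y hy hyx using key
  refine hK y hy x ?_
  filter_upwards [ae_all_iff.2 hyx] with ω h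
  refine tendsto_pi_nhds.1 (tendsto_iff_dist_tendsto_zero.2 ?_ :
    Tendsto (fun n => pt (y n) ω) atTop (𝓝 (pt x ω)))
  exact squeeze_zero (fun _ => dist_nonneg) (fun n => (h n).le) tendsto_one_div_add_atTop_nhds_zero_nat

theorem IsAESeqClosed.isClosed {K : Set (L0d P d)} (hK : IsAESeqClosed K) :
    IsClosed[stableTopology P d] K :=
  (@isClosed_of_closure_subset _ (stableTopology P d) _) fun _ hx =>
    hK.mem_of_approx (mem_closure_iff_dist.1 hx)

theorem isAESeqClosed_setOf_ae_mem {T : Ω → Set (Fin d → ℝ)} (hT : ∀ ω, IsClosed (T ω)) :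
    IsAESeqClosed {x : L0d P d | ∀ᵐ ω ∂P, pt x ω ∈ T ω} := by
  intro x hx y hy
  filter_upwards [ae_all_iff.2 hx, hy] with ω h1 h2
  exact (hT ω).mem_of_tendsto (tendsto_pi_nhds.2 h2 : Tendsto (fun n => pt (x n) ω) atTop
    (𝓝 (pt y ω))) (Eventually.of_forall h1)

/-! ### Selector sets: stability, closedness, boundedness, uniqueness. -/

theorem IsMeasurableCompactValued.isStable_selectors {S : Ω → Set (Fin d → ℝ)}
    (hS : IsMeasurableCompactValued S) : IsStable (measurableSelectors P S) := by
  refine isStable_iff.2 ⟨?_, fun N _ x hx y hy => ?_⟩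
  · obtain ⟨f, hf, hfS⟩ := hS.exists_selector
    obtain ⟨x, hx⟩ := exists_pt_eq P hf
    refine ⟨x, (mem_measurableSelectors_iff hS).2 ?_⟩
    filter_upwards [hx] with ω h
    rw [h]
    exact hfS ω
  · simp only [mem_measurableSelectors_iff hS] at hx ⊢
    filter_upwards [hy, ae_all_iff.2 hx] with ω h1 h2
    rw [h1]
    exact h2 _

theorem IsMeasurableCompactValued.isAESeqClosed_selectors {S : Ω → Set (Fin d → ℝ)}
    (hS : IsMeasurableCompactValued S) : IsAESeqClosed (measurableSelectors P S) := by
  have : measurableSelectors P S = {x | ∀ᵐ ω ∂P, pt x ω ∈ S ω} :=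
    Set.ext fun x => mem_measurableSelectors_iff hS
  rw [this]
  exact isAESeqClosed_setOf_ae_mem fun ω => (hS.isCompact ω).isClosed

theorem IsMeasurableCompactValued.isL0Bounded_selectors {S : Ω → Set (Fin d → ℝ)}
    (hS : IsMeasurableCompactValued S) : IsL0Bounded (measurableSelectors P S) := by
  classical
  obtain ⟨x₀, hx₀⟩ := (hS.isStable_selectors (P := P)).1
  have hex : ∀ ω, ∃ n : ℕ, ¬ (S ω ∩ {v | (n : ℝ) ≤ ‖v‖}).Nonempty := by
    intro ω
    obtain ⟨c, hc⟩ := (hS.isCompact ω).isBounded.exists_norm_le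
    obtain ⟨n, hn⟩ := exists_nat_gt c
    exact ⟨n, fun ⟨v, hv, hvn⟩ => absurd ((hc v hv).trans_lt hn) (not_lt.2 hvn)⟩
  obtain ⟨N, hN, hNS⟩ : ∃ N : Ω → ℕ, Measurable N ∧ ∀ ω, ∀ v ∈ S ω, ‖v‖ ≤ N ω := by
    refine ⟨fun ω => Nat.find (hex ω), measurable_find hex fun n =>
      (hS.measurable _ (isClosed_le continuous_const continuous_norm)).compl, fun ω v hv => ?_⟩
    by_contra hlt
    exact Nat.find_spec (hex ω) ⟨v, hv, (not_le.1 hlt).le⟩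
  refine isL0Bounded_iff.2 ⟨x₀, hx₀, fun ω => (N ω : ℝ) + N ω,
    (measurable_from_nat.comp hN).add (measurable_from_nat.comp hN), fun x hx => ?_⟩
  rw [mem_measurableSelectors_iff hS] at hx hx₀
  filter_upwards [hx, hx₀] with ω h1 h2
  exact (dist_le_norm_add_norm _ _).trans (add_le_add (hNS _ _ h1) (hNS _ _ h2))

theorem IsStable.exists_eq_selectors [IsFiniteMeasure P] {K : Set (L0d P d)} (hK : IsStable K)
    (hc : IsAESeqClosed K) (hb : IsL0Bounded K) :
    ∃ S : Ω → Set (Fin d → ℝ), IsMeasurableCompactValued S ∧ K = measurableSelectors P S := by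
  obtain ⟨x₀, -, M, -, hM⟩ := isL0Bounded_iff.1 hb
  obtain ⟨S, hS, hKS, hSK⟩ := hK.exists_multifunction hM
  refine ⟨S, hS, Set.ext fun x => ?_⟩
  rw [mem_measurableSelectors_iff hS]
  exact ⟨hKS x, fun hx => hc.mem_of_approx (hSK x hx)⟩

theorem ae_subset_of_selectors_eq {S S' : Ω → Set (Fin d → ℝ)}
    (hS : IsMeasurableCompactValued S) (hS' : IsMeasurableCompactValued S')
    (h : measurableSelectors P S = measurableSelectors P S') : ∀ᵐ ω ∂P, S ω ⊆ S' ω := by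
  refine hS.ae_subset (fun ω => (hS'.isCompact ω).isClosed) fun x hx => ?_
  rwa [← mem_measurableSelectors_iff hS', ← h, mem_measurableSelectors_iff hS]

/-! ### Stable compactness of bounded sequentially closed stable sets. -/

theorem IsStable.isStableCompact [IsFiniteMeasure P] {K : Set (L0d P d)} (hK : IsStable K)
    (hc : IsAESeqClosed K) (hb : IsL0Bounded K) : IsStableCompact K := by
  classical
  refine ⟨hK, ?_⟩
  rintro F ⟨B, hB, hBK, hF⟩
  obtain ⟨x₀, -, M, -, hM⟩ := isL0Bounded_iff.1 hb
  have : Nonempty B := hB.1.to_subtype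
  have hmf : ∀ Y : B, ∃ S : Ω → Set (Fin d → ℝ), IsMeasurableCompactValued S ∧
      (∀ y ∈ Y.1, ∀ᵐ ω ∂P, pt y ω ∈ S ω) ∧
      ∀ x : L0d P d, (∀ᵐ ω ∂P, pt x ω ∈ S ω) → ∀ r : L0 P, (∀ᵐ ω ∂P, 0 < r ω) →
        ∃ y ∈ Y.1, ∀ᵐ ω ∂P, dist (pt y ω) (pt x ω) < r ω :=
    fun Y => (hB.2.1 Y Y.2).exists_multifunction fun y hy => hM y (hBK Y Y.2 hy)
  choose S hS hYS hSY using hmf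
  have hmono : ∀ Y Z : B, Y.1 ⊆ Z.1 → ∀ᵐ ω ∂P, S Y ω ⊆ S Z ω := by
    intro Y Z hYZ
    have hcl : ∀ ω, IsClosed (S Z ω) := fun ω => ((hS Z).isCompact ω).isClosed
    refine (hS Y).ae_subset hcl fun x hx => ?_
    refine (isAESeqClosed_setOf_ae_mem hcl).mem_of_approx fun r hr => ?_
    obtain ⟨y, hy, h⟩ := hSY Y x hx r hr
    exact ⟨y, hYS Z y (hYZ hy), h⟩
  have hdir : ∀ Y Z : B, ∃ W : B, W.1 ⊆ Y.1 ∧ W.1 ⊆ Z.1 := by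
    intro Y Z
    obtain ⟨W, hW, h⟩ := hF.mem_iff.1 (inter_mem (hF.mem_of_mem Y.2) (hF.mem_of_mem Z.2))
    exact ⟨⟨W, hW⟩, h.trans Set.inter_subset_left, h.trans Set.inter_subset_right⟩
  -- For each grid ball, countably many members of the base detect, up to null sets, where some `S
  -- Y` misses that ball.
  have hcov : ∀ j, ∃ u : ℕ → B, ∀ Y : B, ∀ᵐ ω ∂P,
      ω ∈ {ω | (S Y ω ∩ gridBall d j).Nonempty}ᶜ →
        ∃ n, ω ∈ {ω | (S (u n) ω ∩ gridBall d j).Nonempty}ᶜ :=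
    fun j => exists_seq_ae_cover P fun Y => ((hS Y).measurable _ (isClosed_gridBall j)).compl
  choose u hu using hcov
  obtain ⟨e, he⟩ := exists_surjective_nat ((ℕ × ℕ) × ℕ)
  choose D hD1 hD2 using hdir
  let W : ℕ → B := fun n => u (e n).1 (e n).2
  -- A decreasing chain refining all the detecting members `W n`.
  let Z : ℕ → B := fun n => Nat.rec (W 0) (fun n Y => D Y (W (n + 1))) n
  have hZ : ∀ n, (Z (n + 1)).1 ⊆ (Z n).1 := fun n => hD1 _ _
  have hZW : ∀ n, (Z n).1 ⊆ (W n).1 := fun n => by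
    cases n with
    | zero => exact subset_rfl
    | succ n => exact hD2 _ _
  obtain ⟨G, hG, hGm, hGZ⟩ := (ae_all_iff.2 fun n => (hmono _ _ (hZ n)).and
    (hmono _ _ (hZW n))).exists_measurable_mem
  have hT := IsMeasurableCompactValued.iInter
    (S := fun n ω => if ω ∈ G then S (Z n) ω else {0})
    (fun n => (hS (Z n)).ite isMeasurableCompactValued_singleton_zero hGm) fun ω n => by
      split_ifs with hω
      exacts [(hGZ ω hω n).1, subset_rfl]
  obtain ⟨f, hf, hfT⟩ := hT.exists_selector
  obtain ⟨x, hx⟩ := exists_pt_eq P hf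
  have hxZ : ∀ᵐ ω ∂P, ∀ n, pt x ω ∈ S (Z n) ω := by
    filter_upwards [hx, hG] with ω h1 h2 n
    have := Set.mem_iInter.1 (hfT ω) n
    rwa [if_pos h2, ← h1] at this
  -- If `S Y ω` missed a grid ball around `pt x ω`, so would some `S (W k) ω`, although it contains
  -- `pt x ω`.
  have hxY : ∀ Y : B, ∀ᵐ ω ∂P, pt x ω ∈ S Y ω := by
    intro Y
    filter_upwards [hxZ, hG, ae_all_iff.2 fun j => hu j Y] with ω h1 h2 h3
    refine mem_of_forall_gridBall ((hS Y).isCompact ω).isClosed fun j hj => ?_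
    by_contra hne
    obtain ⟨n, hn⟩ := h3 j hne
    obtain ⟨k, hk⟩ := he (j, n)
    have hxW := (hGZ ω h2 k).2 (h1 k)
    simp only [W, hk] at hxW
    exact hn ⟨_, hxW, hj⟩
  refine ⟨x, hc.mem_of_approx fun r hr => ?_,
    (clusterPt_iff_dist hF).2 fun Y hY => hSY ⟨Y, hY⟩ x (hxY ⟨Y, hY⟩)⟩
  obtain ⟨y, hy, h⟩ := hSY (Z 0) x (hxY _) r hr
  exact ⟨y, hBK _ (Z 0).2 hy, h⟩

/-! ### Closedness and boundedness of stable compact sets. -/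

/-- Stable compactness applied to the filter generated by the local conditions
`R ω (r ω) (y ω)` for strictly positive `r`. -/
theorem IsStableCompact.exists_clusterPt_of_local {K : Set (L0d P d)} (hK : IsStableCompact K)
    {R : Ω → ℝ → (Fin d → ℝ) → Prop} (hmono : ∀ ω s t v, s ≤ t → R ω s v → R ω t v)
    (hne : ∀ r : L0 P, (∀ᵐ ω ∂P, 0 < r ω) → ∃ y ∈ K, ∀ᵐ ω ∂P, R ω (r ω) (pt y ω)) :
    ∃ x ∈ K, ∀ r : L0 P, (∀ᵐ ω ∂P, 0 < r ω) → ∀ s : L0 P, (∀ᵐ ω ∂P, 0 < s ω) →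
      ∃ y ∈ K, (∀ᵐ ω ∂P, R ω (r ω) (pt y ω)) ∧ ∀ᵐ ω ∂P, dist (pt y ω) (pt x ω) < s ω := by
  classical
  have hKs := (isStable_iff.1 hK.1).2
  let C : L0 P → Set (L0d P d) := fun r => {y ∈ K | ∀ᵐ ω ∂P, R ω (r ω) (pt y ω)}
  let B : Set (Set (L0d P d)) := {Y | ∃ r : L0 P, (∀ᵐ ω ∂P, 0 < r ω) ∧ Y = C r}
  have hone : ∀ᵐ ω ∂P, 0 < (1 : L0 P) ω := by
    filter_upwards [AEEqFun.coeFn_one (μ := P) (α := Ω) (β := ℝ)] with ω h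
    simp [h]
  have hBs : IsStableCollection B := by
    refine ⟨⟨C 1, 1, hone, rfl⟩, ?_, fun A hA Y hY => ?_⟩
    · rintro _ ⟨r, hr, rfl⟩
      refine isStable_iff.2 ⟨hne r hr, fun N hN x hx y hy => ⟨hKs N hN x (fun k => (hx k).1) y hy, ?_⟩⟩
      filter_upwards [hy, ae_all_iff.2 fun k => (hx k).2] with ω h1 h2
      rw [h1]
      exact h2 _
    · choose r hr hYr using hY
      obtain ⟨N, hN, hAN⟩ := hA.exists_index
      obtain ⟨q, hq⟩ := exists_L0_eq P (f := fun ω => r (N ω) ω)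
        ((measurable_from_prod_countable_right (f := fun q : ℕ × Ω => r q.1 q.2)
          fun n => (r n).measurable).comp (hN.prodMk measurable_id))
      refine ⟨q, ?_, Set.Subset.antisymm ?_ ?_⟩
      · filter_upwards [hq, ae_all_iff.2 hr] with ω h1 h2
        rw [h1]
        exact h2 _
      · rintro y ⟨x, hx, hxy⟩
        simp only [hYr] at hx
        rw [isConcat_iff hAN] at hxy
        refine ⟨hKs N hN x (fun k => (hx k).1) y hxy, ?_⟩
        filter_upwards [hxy, hq, ae_all_iff.2 fun k => (hx k).2] with ω h1 h2 h3
        rw [h1, h2]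
        exact h3 _
      -- Here `z` is known to satisfy the condition for `r k` only where `N = k`; elsewhere it is
      -- replaced by some `w k ∈ C (r k)`.
      · rintro z ⟨hzK, hzq⟩
        choose w hwK hw using fun k => hne (r k) (hr k)
        have hmeas : ∀ k, MeasurableSet {ω | N ω = k} := fun k => hN (measurableSet_singleton k)
        have hglue : ∀ k, ∃ x : L0d P d, ∀ᵐ ω ∂P,
            pt x ω = if N ω = k then pt z ω else pt (w k) ω :=
          fun k => exists_pt_eq P ((measurable_pt z).ite (hmeas k) (measurable_pt (w k)))
        choose x hx using hglue
        refine ⟨x, fun k => ?_, (isConcat_iff hAN).2 ?_⟩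
        · rw [hYr]
          constructor
          · refine hKs (fun ω => if N ω = k then 0 else 1)
              (measurable_const.ite (hmeas k) measurable_const)
              (fun n => if n = 0 then z else w k) (fun n => ?_) _ ?_
            · split_ifs
              exacts [hzK, hwK k]
            · filter_upwards [hx k] with ω h
              rw [h]
              by_cases hk : N ω = k <;> simp [hk]
          · filter_upwards [hx k, hzq, hw k, hq] with ω h1 h2 h3 h4
            rw [h1]
            by_cases hk : N ω = k
            · rw [h4, hk] at h2
              simpa [hk] using h2
            · simpa [hk] using h3
        · filter_upwards [ae_all_iff.2 hx] with ω h
          rw [h]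
          simp
  let FB : FilterBasis (L0d P d) :=
    { sets := B
      nonempty := hBs.1
      inter_sets := by
        rintro _ _ ⟨r, hr, rfl⟩ ⟨q, hq, rfl⟩
        refine ⟨C (r ⊓ q), ⟨r ⊓ q, ?_, rfl⟩, fun y hy => ⟨⟨hy.1, ?_⟩, ⟨hy.1, ?_⟩⟩⟩
        · filter_upwards [hr, hq, AEEqFun.coeFn_inf r q] with ω h1 h2 h3
          rw [h3]
          exact lt_min h1 h2
        · filter_upwards [hy.2, AEEqFun.coeFn_inf r q] with ω h1 h2
          exact hmono _ _ _ _ (h2.le.trans inf_le_left) h1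
        · filter_upwards [hy.2, AEEqFun.coeFn_inf r q] with ω h1 h2
          exact hmono _ _ _ _ (h2.le.trans inf_le_right) h1 }
  have hFB : FB.filter.HasBasis (fun Y => Y ∈ B) id := FB.hasBasis
  obtain ⟨x, hxK, hx⟩ := hK.2 FB.filter ⟨B, hBs, by rintro _ ⟨r, -, rfl⟩ y hy; exact hy.1, hFB⟩
  refine ⟨x, hxK, fun r hr s hs => ?_⟩
  obtain ⟨y, hy, h⟩ := (clusterPt_iff_dist hFB).1 hx (C r) ⟨r, hr, rfl⟩ s hs
  exact ⟨y, hy.1, hy.2, h⟩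

/-- The elements of `K` near a closure point `y` generate a stable filter whose cluster point in `K`
can only be `y`. -/
theorem IsStableCompact.isClosed {K : Set (L0d P d)} (hK : IsStableCompact K) :
    IsClosed[stableTopology P d] K := by
  refine (@isClosed_of_closure_subset _ (stableTopology P d) _) fun y hy => ?_
  obtain ⟨x, hxK, hx⟩ := hK.exists_clusterPt_of_local
    (R := fun ω t v => dist v (pt y ω) < t) (fun _ _ _ _ hst h => h.trans_le hst)
    (mem_closure_iff_dist.1 hy)
  have key : ∀ n : ℕ, ∀ᵐ ω ∂P, dist (pt y ω) (pt x ω) ≤ 1 / (n + 1) + 1 / (n + 1) := by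
    intro n
    obtain ⟨q, hq⟩ := exists_L0_eq P (f := fun _ => 1 / ((n : ℝ) + 1)) measurable_const
    have hq0 : ∀ᵐ ω ∂P, 0 < q ω := by
      filter_upwards [hq] with ω h
      rw [h]
      positivity
    obtain ⟨z, -, hz1, hz2⟩ := hx q hq0 q hq0
    filter_upwards [hq, hz1, hz2] with ω h1 h2 h3
    rw [h1] at h2 h3
    exact (dist_triangle_left _ _ _).trans (add_le_add h2.le h3.le)
  rw [eq_of_pt_ae_eq (P := P) (x := y) (y := x)]
  · exact hxK
  · filter_upwards [ae_all_iff.2 key] with ω h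
    refine dist_le_zero.1 (ge_of_tendsto' (x := atTop) ?_ h)
    simpa using (tendsto_one_div_add_atTop_nhds_zero_nat (𝕜 := ℝ)).add
      (tendsto_one_div_add_atTop_nhds_zero_nat (𝕜 := ℝ))

theorem IsStableCompact.isL0Bounded [IsFiniteMeasure P] {K : Set (L0d P d)}
    (hK : IsStableCompact K) : IsL0Bounded K := by
  classical
  obtain ⟨x₀, hx₀⟩ := hK.1.1
  obtain ⟨u, huK, hu⟩ := exists_seq_ae_dense hK.1.1
  have hdm : ∀ x : L0d P d, Measurable fun ω => dist (pt x ω) (pt x₀ ω) :=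
    fun x => (measurable_pt x).dist (measurable_pt x₀)
  -- The event where the dense sequence is unbounded. Demanding `dist > 1 / t` there is satisfiable
  -- for all positive `t`, but no cluster point survives unless `A` is null.
  let A : Set Ω := {ω | ∀ m : ℕ, ∃ n, (m : ℝ) < dist (pt (u n) ω) (pt x₀ ω)}
  have hA : MeasurableSet A := by
    simp only [A, Set.ofPred_forall, Set.ofPred_exists]
    exact MeasurableSet.iInter fun m => MeasurableSet.iUnion fun n =>
      measurableSet_lt measurable_const (hdm _)
  have hA0 : ∀ᵐ ω ∂P, ω ∉ A := by
    obtain ⟨x, -, hx⟩ := hK.exists_clusterPt_of_local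
      (R := fun ω t v => ω ∈ A → 1 < t * dist v (pt x₀ ω))
      (fun ω s t v hst h hω => (h hω).trans_le (by gcongr)) fun r hr => by
        obtain ⟨z, hz, h⟩ := hK.1.exists_select huK
          (p := fun n ω => ω ∈ A → 1 < r ω * dist (pt (u n) ω) (pt x₀ ω))
          (fun n => by
            simp only [imp_iff_not_or, Set.ofPred_or]
            exact hA.compl.union
              (measurableSet_lt measurable_const (r.measurable.mul (hdm _)))) (by
            filter_upwards [hr] with ω h1
            by_cases hω : ω ∈ A
            · obtain ⟨m, hm⟩ := exists_nat_gt (1 / r ω)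
              obtain ⟨n, hn⟩ := hω m
              refine ⟨n, fun _ => ?_⟩
              have := hm.trans hn
              rwa [div_lt_iff₀' h1] at this
            · exact ⟨0, fun h => absurd h hω⟩)
        refine ⟨z, hz, ?_⟩
        filter_upwards [h] with ω ⟨n, h1, h2⟩
        rwa [h2]
    obtain ⟨s, hs⟩ := exists_L0_eq P (f := fun _ => (1 : ℝ)) measurable_const
    -- On `A` this `r` forces `y` farther than `dist x x₀ + 1` from `x₀`, while `s = 1` keeps it
    -- within `1` of `x`.
    obtain ⟨r, hr⟩ := exists_L0_eq P (f := fun ω => 1 / (dist (pt x ω) (pt x₀ ω) + 1))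
      (((hdm x).add_const 1).const_div 1)
    obtain ⟨y, -, hy1, hy2⟩ := hx r (by
        filter_upwards [hr] with ω h
        rw [h]
        positivity) s (by
        filter_upwards [hs] with ω h
        rw [h]
        exact one_pos)
    filter_upwards [hs, hr, hy1, hy2] with ω h1 h2 h3 h4 hω
    have h5 := h3 hω
    rw [h2, one_div, inv_mul_eq_div, one_lt_div (by positivity)] at h5
    rw [h1] at h4
    linarith [dist_triangle (pt y ω) (pt x ω) (pt x₀ ω)]
  have hex : ∀ ω, ∃ m : ℕ, ω ∈ A ∨ ∀ n, dist (pt (u n) ω) (pt x₀ ω) ≤ m := by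
    intro ω
    by_cases hω : ω ∈ A
    · exact ⟨0, Or.inl hω⟩
    · have hω' : ∃ m : ℕ, ∀ n, dist (pt (u n) ω) (pt x₀ ω) ≤ m := by
        simpa only [A, Set.mem_ofPred_eq, not_forall, not_exists, not_lt] using hω
      exact hω'.imp fun m hm => Or.inr hm
  have hM : Measurable fun ω => Nat.find (hex ω) := measurable_find hex fun m => by
    simp only [Set.ofPred_or, Set.ofPred_forall]
    exact hA.union (MeasurableSet.iInter fun n => measurableSet_le (hdm _) measurable_const)
  refine isL0Bounded_iff.2 ⟨x₀, hx₀, fun ω => (Nat.find (hex ω) : ℝ),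
    measurable_from_nat.comp hM, fun x hx => ?_⟩
  filter_upwards [hA0, hu x hx] with ω h1 h2
  have h3 : closure (Set.range fun n => pt (u n) ω) ⊆
      Metric.closedBall (pt x₀ ω) (Nat.find (hex ω)) := by
    refine closure_minimal ?_ Metric.isClosed_closedBall
    rintro _ ⟨n, rfl⟩
    exact (Nat.find_spec (hex ω)).resolve_left h1 n
  exact h3 h2

end StableL0

theorem mainTheorem2 {Ω : Type*} [MeasurableSpace Ω] (P : Measure Ω) [IsProbabilityMeasure P]
    (d : ℕ) (K : Set (StableL0.L0d P d)) :
    List.TFAE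
      [StableL0.IsStableCompact K,
       StableL0.IsStable K ∧ IsClosed[StableL0.stableTopology P d] K ∧ StableL0.IsL0Bounded K,
       StableL0.IsStable K ∧ StableL0.IsAESeqClosed K ∧ StableL0.IsL0Bounded K,
       ∃ S : Ω → Set (Fin d → ℝ), StableL0.IsMeasurableCompactValued S ∧
         K = StableL0.measurableSelectors P S] ∧
    ∀ S S' : Ω → Set (Fin d → ℝ),
      StableL0.IsMeasurableCompactValued S → K = StableL0.measurableSelectors P S →
      StableL0.IsMeasurableCompactValued S' → K = StableL0.measurableSelectors P S' →
      ∀ᵐ ω ∂P, S ω = S' ω := by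
  refine ⟨?_, fun S S' hS hKS hS' hKS' => ?_⟩
  · tfae_have 1 → 2 := fun h => ⟨h.1, h.isClosed, h.isL0Bounded⟩
    tfae_have 2 → 3 := fun h => ⟨h.1, h.1.isAESeqClosed h.2.1, h.2.2⟩
    tfae_have 3 → 1 := fun h => h.1.isStableCompact h.2.1 h.2.2
    tfae_have 3 → 4 := fun h => h.1.exists_eq_selectors h.2.1 h.2.2
    tfae_have 4 → 3 := by
      rintro ⟨S, hS, rfl⟩
      exact ⟨hS.isStable_selectors, hS.isAESeqClosed_selectors, hS.isL0Bounded_selectors⟩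
    tfae_finish
  · filter_upwards [StableL0.ae_subset_of_selectors_eq hS hS' (hKS.symm.trans hKS'),
      StableL0.ae_subset_of_selectors_eq hS' hS (hKS'.symm.trans hKS)] with ω h1 h2
    exact h1.antisymm h2
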